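/- Let $p$ be an odd prime, $q=p^m$, and let $r,s\ge 1$ be integers. Write $q=2^ab+1$ or $q=2^ab-1$ with $a\ge 2$ and $b$ odd, and let $\beta$ be a primitive $2^r$-th root of unity in an extension field of $\mathbb F_q$. For $h\in\mathbb Z/2^r$ let $m_h(x)$ be the minimal polynomial of $\beta^h$ over $\mathbb F_q$. If $q=2^ab+1$, put, for an integer $1\le l\le r$, $T(l)=\{0,2^{r-1}\}\cup\bigcup_{i=2}^{l}2^{r-i}D_i$, where $D_i=\{\pm1,\pm3,\dots,\pm3^{2^{i-2}-1}\}$ for $2\le i\le a$ and $D_i=\{\pm1,\pm3,\dots,\pm3^{2^{a-2}-1}\}$ for $i\ge a+1$, and let $T=T(r)$. If $q=2^ab-1$, put $T=\{0,2^{r-1},2^{r-2}\}\cup\bigcup_{i=3}^{r}2^{r-i}O_i$ (and $T=\{0,1\}$ for $r=1$), where $O_i=\{\pm1\}$ if $a=2$, and, if $a\ge3$, $O_i=\{1,3,\dots,3^{2^{i-2}-1}\}$ for $3\le i\le a$ and $O_i=\{\pm1,\pm3,\dots,\pm3^{2^{a-2}-1}\}$ for $i\ge a+1$. All elements are taken modulo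 $2^r$; in both cases $T$ is a complete set of representatives of the $q$-cyclotomic cosets modulo $2^r$. For exponents $0\le j_h\le p^s$ $(h\in T)$ let $C=\big\langle\prod_{h\in T}m_h(x)^{j_h}\big\rangle$ be the cyclic code of length $n=2^rp^s$ over $\mathbb F_q$ generated by $\prod_{h\in T}m_h(x)^{j_h}$ in $\mathbb F_q[x]/(x^n-1)$. An $[[n,k,d]]_q$ quantum error-correcting (QEC) code is a $q^k$-dimensional subspace of $(\mathbb C^q)^{\otimes n}$ that detects every error operator $\varsigma^iX_{\mathbf a}Z_{\mathbf b}$ of weight less than $d$ but not every one of weight $d$, where $\varsigma=e^{2\pi i/p}$, $X_{\mathbf a}|\mathbf x\rangle=|\mathbf x+\mathbf a\rangle$ and $Z_{\mathbf b}|\mathbf x\rangle=\varsigma^{\mathrm{Tr}(\mathbf x\cdot\mathbf b)}|\mathbf x\rangle$. It is called MDS if $k=n-2d+2$. The CSS code of a linear code $C$ with $C^\perp\subseteq C$ (Euclidean dual) is the span of the states $\sum_{\mathbf c\in C^\perp}|\mathbf x+\mathbf c\rangle$, $\mathbf x\in C$. Then: (A) Let $q=2^ab+1$ and $a\ge r$.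 (1) If $j_h=0$ for all $h\in T$, then $C^\perp\subseteq C$ and the CSS code of $C$ is an MDS QEC code with parameters $[[2^rp^s,2^rp^s,1]]_q$. (2) If $\sum_{h\in T}j_h=1$, then $C^\perp\subseteq C$ and the CSS code of $C$ is an MDS QEC code with parameters $[[2^rp^s,2^rp^s-2,2]]_q$. (B) Let $q=2^ab+1$ and $a<r$. (1) If $j_h=0$ for all $h\in T$, the conclusion of (A)(1) holds. (2) If $\sum_{h\in T(a)}j_h=1$ and $j_h=0$ for all $h\in T\setminus T(a)$, the conclusion of (A)(2) holds. (C) Let $q=2^ab-1$. (1) If $j_h=0$ for all $h\in T$, the conclusion of (A)(1) holds. (2) If $j_h=1$ for one $h\in\{0,2^{r-1}\}$ and $j_{h'}=0$ for all other $h'\in T$, the conclusion of (A)(2) holds. -/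

import Mathlib

open Polynomial

noncomputable section

/-! ### Linear and cyclic codes -/

namespace QCode

/-- The Euclidean dual `C^⊥` of a linear code `C ⊆ F^n`. -/
def dualCode {F : Type*} [Field F] {n : ℕ} (C : Submodule F (Fin n → F)) :
    Submodule F (Fin n → F) where
  carrier := {x | ∀ y ∈ C, x ⬝ᵥ y = 0}
  zero_mem' := fun y _ => zero_dotProduct y
  add_mem' := fun {x x'} hx hx' y hy => by
    rw [add_dotProduct, hx y hy, hx' y hy, add_zero]
  smul_mem' := fun c x hx y hy => by
    rw [smul_dotProduct, hx y hy, smul_zero]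

/-- The vector `(c_0, …, c_{n-1})` as the residue class of `∑ c_i x^i` in `F[x]/(x^n - 1)`. -/
def toQuotient (F : Type*) [Field F] (n : ℕ) :
    (Fin n → F) →ₗ[F] (F[X] ⧸ Ideal.span {(X ^ n - 1 : F[X])}) :=
  (Ideal.Quotient.mkₐ F (Ideal.span {(X ^ n - 1 : F[X])})).toLinearMap ∘ₗ
    ∑ i : Fin n, (Polynomial.monomial (i : ℕ)) ∘ₗ (LinearMap.proj i : (Fin n → F) →ₗ[F] F)

/-- The cyclic code `⟨g(x)⟩` of length `n`: all vectors whose class lies in the ideal of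
`F[x]/(x^n - 1)` generated by `g`. -/
def cyclicCode {F : Type*} [Field F] (n : ℕ) (g : F[X]) : Submodule F (Fin n → F) :=
  ((Ideal.span {Ideal.Quotient.mk (Ideal.span {(X ^ n - 1 : F[X])}) g}).restrictScalars F).comap
    (toQuotient F n)

/-! ### Representatives of the cyclotomic cosets modulo `2^r` -/

/-- `2^{r-i} D_i` for `q = 2^a b + 1`, where `D_i = {±1, ±3, …, ±3^{N-1}}` with `N = 2^{a-2}` if
`a + 1 ≤ i` and `N = 2^{i-2}` if `2 ≤ i ≤ a`. -/
def layerD (a r i : ℕ) : Finset (ZMod (2 ^ r)) :=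
  (Finset.range (if a + 1 ≤ i then 2 ^ (a - 2) else 2 ^ (i - 2))).biUnion
    fun t => {2 ^ (r - i) * 3 ^ t, -(2 ^ (r - i) * 3 ^ t)}

/-- `{0, 2^{r-1}} ∪ ⋃_{i=2}^{l} 2^{r-i} D_i`, the case `q = 2^a b + 1`. With `l = r` this is the
full set of representatives. -/
def repsD (a r l : ℕ) : Finset (ZMod (2 ^ r)) :=
  {0, 2 ^ (r - 1)} ∪ (Finset.Icc 2 l).biUnion (layerD a r)

/-- `2^{r-i} O_i` for `q = 2^a b - 1`, where `O_i = {±1}` if `a = 2`, and if `a ≥ 3` then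
`O_i = {±1, ±3, …, ±3^{2^{a-2}-1}}` for `a + 1 ≤ i` and `O_i = {1, 3, …, 3^{2^{i-2}-1}}` for
`3 ≤ i ≤ a`. -/
def layerO (a r i : ℕ) : Finset (ZMod (2 ^ r)) :=
  if a = 2 then {2 ^ (r - i), -2 ^ (r - i)}
  else if a + 1 ≤ i then
    (Finset.range (2 ^ (a - 2))).biUnion fun t => {2 ^ (r - i) * 3 ^ t, -(2 ^ (r - i) * 3 ^ t)}
  else (Finset.range (2 ^ (i - 2))).image fun t => 2 ^ (r - i) * 3 ^ t

/-- `{0, 2^{r-1}, 2^{r-2}} ∪ ⋃_{i=3}^{r} 2^{r-i} O_i`, the case `q = 2^a b - 1`.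
(For `r = 1` this reads `{0, 1}`, again the full set of representatives.) -/
def repsO (a r : ℕ) : Finset (ZMod (2 ^ r)) :=
  {0, 2 ^ (r - 1), 2 ^ (r - 2)} ∪ (Finset.Icc 3 r).biUnion (layerO a r)

/-- The generator polynomial `∏_{h ∈ T} m_h(x)^{j_h}`, where `m_h` is the minimal polynomial of
`β^h` over `F`. -/
def genPoly (F : Type*) [Field F] {K : Type*} [Field K] [Algebra F K] {r : ℕ} (β : K)
    (T : Finset (ZMod (2 ^ r))) (j : ZMod (2 ^ r) → ℕ) : F[X] :=
  ∏ h ∈ T, minpoly F (β ^ h.val) ^ j h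

/-! ### Quantum codes -/

/-- The Hilbert space `V_n = (ℂ^q)^{⊗ n}`, in coordinates with respect to the orthonormal basis
`|x⟩`, `x ∈ F^n`. -/
abbrev QSpace (F : Type*) [Fintype F] (n : ℕ) : Type _ := EuclideanSpace ℂ (Fin n → F)

open Classical in
/-- The basis vector `|x⟩`. -/
def ket {F : Type*} [Fintype F] {n : ℕ} (x : Fin n → F) : QSpace F n :=
  EuclideanSpace.single x 1

/-- The operator `X_a`, determined by `X_a |x⟩ = |x + a⟩`. -/
def opX {F : Type*} [Field F] [Fintype F] {n : ℕ} (a : Fin n → F) :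
    QSpace F n →ₗ[ℂ] QSpace F n where
  toFun ψ := WithLp.toLp 2 fun y => ψ (y - a)
  map_add' _ _ := rfl
  map_smul' _ _ := rfl

/-- The operator `Z_b`, determined by `Z_b |x⟩ = ς^{Tr(x·b)} |x⟩` with `ς = exp(2πi/p)` and `Tr`
the trace from `F` to `ℤ/p`. -/
def opZ (p : ℕ) [Fact p.Prime] {F : Type*} [Field F] [Fintype F] [Algebra (ZMod p) F] {n : ℕ}
    (b : Fin n → F) : QSpace F n →ₗ[ℂ] QSpace F n where
  toFun ψ := WithLp.toLp 2 fun y =>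
    ZMod.stdAddChar (Algebra.trace (ZMod p) F (y ⬝ᵥ b)) * ψ y
  map_add' _ _ := by ext y; simp [mul_add]
  map_smul' _ _ := by ext y; simp [mul_left_comm]

theorem opX_ket {F : Type*} [Field F] [Fintype F] {n : ℕ} (a x : Fin n → F) :
    opX a (ket x) = ket (x + a) := by
  ext y
  change (ket x : QSpace F n) (y - a) = (ket (x + a) : QSpace F n) y
  by_cases h : y = x + a
  · subst h
    simp [ket]
  · have h' : ¬ y - a = x := fun e => h (by rw [← e, sub_add_cancel])
    simp [ket, h, h']

theorem opZ_ket (p : ℕ) [Fact p.Prime] {F : Type*} [Field F] [Fintype F] [Algebra (ZMod p) F]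
    {n : ℕ} (b x : Fin n → F) :
    opZ p b (ket x) =
      Complex.exp (2 * Real.pi * Complex.I / p) ^ (Algebra.trace (ZMod p) F (x ⬝ᵥ b)).val •
        ket x := by
  ext y
  by_cases h : y = x
  · subst h
    rw [← Complex.exp_nat_mul]
    simp [opZ, ket, ZMod.stdAddChar_apply, ZMod.toCircle_apply]
    congr 1
    ring
  · simp [opZ, ket, h]

/-- The error operator `ς^i X_a Z_b`. -/
def errorOp (p : ℕ) [Fact p.Prime] {F : Type*} [Field F] [Fintype F] [Algebra (ZMod p) F] {n : ℕ}
    (i : ZMod p) (a b : Fin n → F) : QSpace F n →ₗ[ℂ] QSpace F n :=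
  (ZMod.stdAddChar i : ℂ) • (opX a ∘ₗ opZ p b)

/-- The weight of `ς^i X_a Z_b`: the number of positions on which it acts nontrivially. -/
def errorWeight {F : Type*} [Field F] {n : ℕ} (a b : Fin n → F) : ℕ :=
  {k : Fin n | a k ≠ 0 ∨ b k ≠ 0}.ncard

/-- The code `Q` detects the error `E`: `P E P = c P` for a scalar `c`, where `P` is the orthogonal
projection to `Q`. -/
def Detects {F : Type*} [Fintype F] {n : ℕ} (Q : Submodule ℂ (QSpace F n))
    (E : QSpace F n →ₗ[ℂ] QSpace F n) : Prop :=
  ∃ c : ℂ, ∀ u ∈ Q, ∀ v ∈ Q, inner ℂ u (E v) = c * inner ℂ u v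

/-- `Q ⊆ V_n` is an `[[n, k, d]]_q` code: it has dimension `q^k`, it detects all errors of weight
less than `d`, and it fails to detect some error of weight `d`. (A one-dimensional code detects
every error, so it has no distance in this sense.) -/
structure IsQECCode (p : ℕ) [Fact p.Prime] {F : Type*} [Field F] [Fintype F] [Algebra (ZMod p) F]
    {n : ℕ} (Q : Submodule ℂ (QSpace F n)) (k d : ℕ) : Prop where
  finrank_eq : Module.finrank ℂ Q = Fintype.card F ^ k
  detects : ∀ (i : ZMod p) (a b : Fin n → F), errorWeight a b < d → Detects Q (errorOp p i a b)
  not_detects : ∃ (i : ZMod p) (a b : Fin n → F),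
    errorWeight a b = d ∧ ¬ Detects Q (errorOp p i a b)

/-- `Q` is an `[[n, k, d]]_q` code attaining the quantum Singleton bound `k ≤ n - 2d + 2`. -/
def IsQECMDSCode (p : ℕ) [Fact p.Prime] {F : Type*} [Field F] [Fintype F] [Algebra (ZMod p) F]
    {n : ℕ} (Q : Submodule ℂ (QSpace F n)) (k d : ℕ) : Prop :=
  IsQECCode p Q k d ∧ (k : ℤ) = n - 2 * d + 2

open Classical in
/-- The CSS code of linear codes `C' ⊆ C`: the span of the states `|x + C'⟩ = ∑_{c ∈ C'} |x + c⟩`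
(up to normalization) for `x ∈ C`. -/
def cssCode {F : Type*} [Field F] [Fintype F] {n : ℕ} (C C' : Submodule F (Fin n → F)) :
    Submodule ℂ (QSpace F n) :=
  Submodule.span ℂ {ψ | ∃ x ∈ C, ψ = ∑ c : C', ket (x + (c : Fin n → F))}

/-- The CSS construction applied to `C` and `C' = C^⊥` is possible, that is `C^⊥ ⊆ C`, and gives
an `[[n, k, d]]_q` MDS code. -/
def CSSGivesMDS (p : ℕ) [Fact p.Prime] {F : Type*} [Field F] [Fintype F] [Algebra (ZMod p) F]
    {n : ℕ} (C : Submodule F (Fin n → F)) (k d : ℕ) : Prop :=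
  dualCode C ≤ C ∧ IsQECMDSCode p (cssCode C (dualCode C)) k d

end QCode

end

namespace QCode

/-! ### CSS states as functions on cosets -/

section Quantum

/-! If all exponents vanish, the generator is `1`, so `C` is the whole space and `C^⊥ = 0`. In the
distance-two cases one exponent is `1`, at an `h` killed by a divisor of `q - 1`: `2^r`, `2^a` or
`2`. Then `β^h` is fixed by the `q`-Frobenius, hence equals some `γ ∈ F`, and the generator is `X -
γ`. So `C` is the hyperplane orthogonal to `w = (1, γ, …, γ^(n-1))` and `C^⊥` is the line through
`w`. Since `γ^n = 1` and `p ∣ n`, the sum of the `γ^(2i)` is zero, that is `w ∈ C`. As `w` has no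
zero entry, no vector of weight one is orthogonal to it, whereas a weight-two vector is in `C` but
not in `C^⊥`.

On the quantum side, the CSS code consists of the functions on `F^n` supported on `C` and constant
on cosets of `C^⊥`; this yields its dimension and reduces detection to orthogonality with `C^⊥`
(`isQECCode_cssCode_dualCode`). -/

theorem exists_trace_mul_ne_zero (p : ℕ) [Fact p.Prime] {F : Type*} [Field F] [Finite F]
    [Algebra (ZMod p) F] {c : F} (hc : c ≠ 0) :
    ∃ t : F, Algebra.trace (ZMod p) F (t * c) ≠ 0 := by
  obtain ⟨x, hx⟩ := Algebra.trace_surjective (ZMod p) F 1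
  exact ⟨x * c⁻¹, by rw [inv_mul_cancel_right₀ hc, hx]; exact one_ne_zero⟩

variable {F : Type*} [Field F] [Fintype F] {n : ℕ}

open Classical in
theorem sum_ket_add_apply (C' : Submodule F (Fin n → F)) (x y : Fin n → F) :
    (∑ c : C', ket (x + (c : Fin n → F)) : QSpace F n) y = if y - x ∈ C' then 1 else 0 := by
  have hket : ∀ z : Fin n → F, (ket z : QSpace F n) y = if y = z then 1 else 0 := fun z => by
    simp [ket]
  rw [WithLp.ofLp_sum, Finset.sum_apply]
  simp only [hket]
  split_ifs with h
  · rw [Finset.sum_eq_single (⟨y - x, h⟩ : C')]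
    · simp
    · rintro ⟨b, hb⟩ - hne
      rw [if_neg]
      rintro rfl
      exact hne (by simp)
    · simp
  · refine Finset.sum_eq_zero fun c _ => if_neg ?_
    rintro rfl
    exact h (by simp)

theorem cssCode_eq_zero_of_notMem {C C' : Submodule F (Fin n → F)} (h : C' ≤ C)
    {ψ : QSpace F n} (hψ : ψ ∈ cssCode C C') {y : Fin n → F} (hy : y ∉ C) : ψ y = 0 := by
  classical
  induction hψ using Submodule.span_induction with
  | mem ψ hψ =>
    obtain ⟨x, hx, rfl⟩ := hψ
    rw [sum_ket_add_apply, if_neg]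
    intro hyx
    exact hy (by simpa using C.add_mem (h hyx) hx)
  | zero => rfl
  | add u v _ _ hu hv => simp [hu, hv]
  | smul c u _ hu => simp [hu]

theorem cssCode_apply_add {C C' : Submodule F (Fin n → F)} {ψ : QSpace F n}
    (hψ : ψ ∈ cssCode C C') (y : Fin n → F) {d : Fin n → F} (hd : d ∈ C') :
    ψ (y + d) = ψ y := by
  classical
  induction hψ using Submodule.span_induction with
  | mem ψ hψ =>
    obtain ⟨x, hx, rfl⟩ := hψ
    rw [sum_ket_add_apply, sum_ket_add_apply, add_sub_right_comm, C'.add_mem_iff_left hd]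
  | zero => rfl
  | add u v _ _ hu hv => simp [hu, hv]
  | smul c u _ hu => simp [hu]

open Classical in
/-- The vector of `V_n` whose coordinates are constant on the cosets of `C'` in `C`, with the
prescribed values, and vanish outside `C`. -/
noncomputable def cosetFunction (C C' : Submodule F (Fin n → F)) :
    ((C ⧸ C'.submoduleOf C) → ℂ) →ₗ[ℂ] QSpace F n where
  toFun f := WithLp.toLp 2 fun y => if h : y ∈ C then f (Submodule.Quotient.mk ⟨y, h⟩) else 0
  map_add' f g := by
    ext y
    by_cases h : y ∈ C <;> simp [h]
  map_smul' c f := by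
    ext y
    by_cases h : y ∈ C <;> simp [h]

theorem cosetFunction_apply_of_mem (C C' : Submodule F (Fin n → F))
    (f : (C ⧸ C'.submoduleOf C) → ℂ) {y : Fin n → F} (h : y ∈ C) :
    cosetFunction C C' f y = f (Submodule.Quotient.mk ⟨y, h⟩) := dif_pos h

theorem cosetFunction_apply_of_notMem (C C' : Submodule F (Fin n → F))
    (f : (C ⧸ C'.submoduleOf C) → ℂ) {y : Fin n → F} (h : y ∉ C) :
    cosetFunction C C' f y = 0 := dif_neg h

theorem cosetFunction_injective (C C' : Submodule F (Fin n → F)) :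
    Function.Injective (cosetFunction C C') := by
  intro f g hfg
  ext c
  obtain ⟨⟨x, hx⟩, rfl⟩ := Submodule.Quotient.mk_surjective _ c
  rw [← cosetFunction_apply_of_mem C C' f hx, ← cosetFunction_apply_of_mem C C' g hx, hfg]

/-- Indicators of cosets go exactly to the spanning states, so the dimension of the code is the
number of cosets. -/
theorem range_cosetFunction {C C' : Submodule F (Fin n → F)} (h : C' ≤ C) :
    LinearMap.range (cosetFunction C C') = cssCode C C' := by
  classical
  apply le_antisymm
  · have key : ∀ c : C ⧸ C'.submoduleOf C,
        cosetFunction C C' (Pi.single c 1) ∈ cssCode C C' := by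
      intro c
      obtain ⟨⟨x, hx⟩, rfl⟩ := Submodule.Quotient.mk_surjective _ c
      refine Submodule.subset_span ⟨x, hx, ?_⟩
      ext y
      rw [sum_ket_add_apply]
      by_cases hy : y ∈ C
      · rw [cosetFunction_apply_of_mem _ _ _ hy, Pi.single_apply]
        congr 1
        rw [Submodule.Quotient.eq]
        rfl
      · rw [cosetFunction_apply_of_notMem _ _ _ hy, if_neg]
        intro hyx
        exact hy (by simpa using C.add_mem (h hyx) hx)
    rintro _ ⟨f, rfl⟩
    have := Fintype.ofFinite (C ⧸ C'.submoduleOf C)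
    rw [pi_eq_sum_univ' f, map_sum]
    refine Submodule.sum_mem _ fun c _ => ?_
    rw [map_smul]
    refine Submodule.smul_mem _ _ ?_
    convert key c using 2
  · refine Submodule.span_le.2 ?_
    rintro _ ⟨x, hx, rfl⟩
    refine ⟨Pi.single (Submodule.Quotient.mk ⟨x, hx⟩) 1, ?_⟩
    ext y
    rw [sum_ket_add_apply]
    by_cases hy : y ∈ C
    · rw [cosetFunction_apply_of_mem _ _ _ hy, Pi.single_apply]
      congr 1
      rw [Submodule.Quotient.eq]
      rfl
    · rw [cosetFunction_apply_of_notMem _ _ _ hy, if_neg]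
      intro hyx
      exact hy (by simpa using C.add_mem (h hyx) hx)

theorem finrank_cssCode {C C' : Submodule F (Fin n → F)} (h : C' ≤ C) {k : ℕ}
    (hk : Module.finrank F C = Module.finrank F C' + k) :
    Module.finrank ℂ (cssCode C C') = Fintype.card F ^ k := by
  classical
  have := Fintype.ofFinite (C ⧸ C'.submoduleOf C)
  rw [← range_cosetFunction h, LinearMap.finrank_range_of_inj (cosetFunction_injective C C'),
    Module.finrank_fintype_fun_eq_card, Module.card_eq_pow_finrank (K := F)]
  congr 1
  have h1 := (C'.submoduleOf C).finrank_quotient_add_finrank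
  have h2 := (Submodule.submoduleOfEquivOfLe h).finrank_eq
  omega

/-! ### Error detection -/

variable (p : ℕ) [Fact p.Prime] [Algebra (ZMod p) F]

theorem errorOp_apply (i : ZMod p) (a b : Fin n → F) (ψ : QSpace F n) (y : Fin n → F) :
    errorOp p i a b ψ y = (ZMod.stdAddChar i : ℂ) *
      (ZMod.stdAddChar (Algebra.trace (ZMod p) F ((y - a) ⬝ᵥ b)) * ψ (y - a)) := rfl

theorem detects_errorOp_zero (Q : Submodule ℂ (QSpace F n)) (i : ZMod p) :
    Detects Q (errorOp p i 0 0) := by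
  refine ⟨ZMod.stdAddChar i, fun u _ v _ => ?_⟩
  rw [← inner_smul_right]
  congr 1
  ext y
  simp [errorOp_apply]

/-- Code states are supported on `C` and their images under the error on `C + a`, which is disjoint
from `C`; all matrix elements vanish. -/
theorem detects_of_notMem {C C' : Submodule F (Fin n → F)} (h : C' ≤ C) (i : ZMod p)
    {a : Fin n → F} (b : Fin n → F) (ha : a ∉ C) :
    Detects (cssCode C C') (errorOp p i a b) := by
  refine ⟨0, fun u hu v hv => ?_⟩
  rw [zero_mul, PiLp.inner_apply]
  refine Finset.sum_eq_zero fun y _ => ?_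
  by_cases hy : y ∈ C
  · have hya : y - a ∉ C := fun hya => ha (by simpa using C.sub_mem hy hya)
    simp [errorOp_apply, cssCode_eq_zero_of_notMem h hv hya]
  · simp [cssCode_eq_zero_of_notMem h hu hy]

/-- Translating the summation variable by a multiple of `d` leaves code states unchanged but
multiplies the matrix element by a character value `ζ ≠ 1`, so it is zero. -/
theorem detects_of_dotProduct_ne_zero {C C' : Submodule F (Fin n → F)} (i : ZMod p)
    {b d : Fin n → F} (hd : d ∈ C') (hdb : d ⬝ᵥ b ≠ 0) :
    Detects (cssCode C C') (errorOp p i 0 b) := by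
  refine ⟨0, fun u hu v hv => ?_⟩
  obtain ⟨t, ht⟩ := exists_trace_mul_ne_zero p hdb
  have htd : t • d ∈ C' := C'.smul_mem t hd
  set ζ : ℂ := ZMod.stdAddChar (Algebra.trace (ZMod p) F (t * (d ⬝ᵥ b))) with hζ
  have hζ1 : ζ ≠ 1 := fun h1 =>
    ht (ZMod.injective_stdAddChar (by rw [← hζ, h1, AddChar.map_zero_eq_one]))
  have hshift : inner ℂ u (errorOp p i 0 b v) = ζ * inner ℂ u (errorOp p i 0 b v) := by
    rw [PiLp.inner_apply]
    conv_lhs => rw [← Equiv.sum_comp (Equiv.addRight (t • d))]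
    rw [Finset.mul_sum]
    refine Finset.sum_congr rfl fun y _ => ?_
    simp only [Equiv.coe_addRight, errorOp_apply, sub_zero, cssCode_apply_add hu y htd,
      cssCode_apply_add hv y htd, add_dotProduct, smul_dotProduct, map_add,
      AddChar.map_add_eq_mul, smul_eq_mul, RCLike.inner_apply]
    rw [← hζ]
    ring
  have h0 : (1 - ζ) * inner ℂ u (errorOp p i 0 b v) = 0 := by
    rw [sub_mul, one_mul, ← hshift, sub_self]
  rw [zero_mul]
  exact (mul_eq_zero.1 h0).resolve_left (sub_ne_zero.2 hζ1.symm)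

/-- `X_a` sends the state of `C'` to that of `a + C'`. These are orthogonal, so detection would
force the latter to have norm zero. -/
theorem not_detects_of_mem_of_notMem {C C' : Submodule F (Fin n → F)} {a : Fin n → F}
    (ha : a ∈ C) (ha' : a ∉ C') : ¬ Detects (cssCode C C') (errorOp p 0 a 0) := by
  classical
  rintro ⟨c, hc⟩
  set u : QSpace F n := ∑ c : C', ket (a + (c : Fin n → F)) with hu
  set v : QSpace F n := ∑ c : C', ket (0 + (c : Fin n → F)) with hv
  have huQ : u ∈ cssCode C C' := Submodule.subset_span ⟨a, ha, rfl⟩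
  have hvQ : v ∈ cssCode C C' := Submodule.subset_span ⟨0, C.zero_mem, rfl⟩
  have hEv : errorOp p 0 a 0 v = u := by
    ext y
    rw [errorOp_apply, hu, hv, sum_ket_add_apply, sum_ket_add_apply]
    simp
  have huv : inner ℂ u v = 0 := by
    rw [PiLp.inner_apply]
    refine Finset.sum_eq_zero fun y _ => ?_
    rw [hu, hv, sum_ket_add_apply, sum_ket_add_apply]
    by_cases h1 : y - a ∈ C'
    · rw [if_neg (c := y - 0 ∈ C')]
      · simp
      · intro h2
        exact ha' (by simpa using C'.sub_mem h2 h1)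
    · simp [h1]
  have huu := hc u huQ v hvQ
  rw [hEv, huv, mul_zero, inner_self_eq_zero] at huu
  have := congrArg (fun ψ : QSpace F n => ψ a) huu
  simp [hu, sum_ket_add_apply] at this

/-- The CSS construction for a code `C ⊇ C^⊥` such that no nonzero vector of weight less than `d`
is orthogonal to `C^⊥`, while `C \ C^⊥` has a vector of weight `d`. -/
theorem isQECCode_cssCode_dualCode {C : Submodule F (Fin n → F)} {k d : ℕ}
    (h : dualCode C ≤ C)
    (hk : Module.finrank F C = Module.finrank F (dualCode C) + k)
    (hd : ∀ x : Fin n → F, x ≠ 0 → errorWeight x 0 < d → ∃ c ∈ dualCode C, c ⬝ᵥ x ≠ 0)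
    (ha : ∃ a ∈ C, a ∉ dualCode C ∧ errorWeight a 0 = d) :
    IsQECCode p (cssCode C (dualCode C)) k d where
  finrank_eq := finrank_cssCode h hk
  detects i a b hab := by
    have hle : ∀ x : Fin n → F, (∀ k, x k ≠ 0 → a k ≠ 0 ∨ b k ≠ 0) → errorWeight x 0 < d :=
      fun x hx => lt_of_le_of_lt
        (Set.ncard_le_ncard (fun k hk => hx k (by simpa using hk)) (Set.toFinite _)) hab
    by_cases ha0 : a = 0
    · subst ha0
      by_cases hb0 : b = 0
      · subst hb0
        exact detects_errorOp_zero p _ i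
      · obtain ⟨c, hc, hcb⟩ := hd b hb0 (hle b fun _ => Or.inr)
        exact detects_of_dotProduct_ne_zero p i hc hcb
    -- Every vector of `C` is orthogonal to `C^⊥`, so this `c` shows `a ∉ C`.
    · obtain ⟨c, hc, hca⟩ := hd a ha0 (hle a fun _ => Or.inl)
      exact detects_of_notMem p h i b fun haC => hca (hc a haC)
  not_detects := by
    obtain ⟨a, haC, haC', hwt⟩ := ha
    exact ⟨0, a, 0, hwt, not_detects_of_mem_of_notMem p haC haC'⟩

/-! ### The full space and a hyperplane -/

theorem cssGivesMDS_top (hn : 0 < n) : CSSGivesMDS p (⊤ : Submodule F (Fin n → F)) n 1 := by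
  classical
  have hdual : dualCode (⊤ : Submodule F (Fin n → F)) = ⊥ := by
    refine (Submodule.eq_bot_iff _).2 fun x hx => ?_
    ext i
    simpa using hx (Pi.single i 1) trivial
  refine ⟨le_top, isQECCode_cssCode_dualCode p le_top ?_ ?_ ?_, by push_cast; ring⟩
  · rw [hdual, finrank_top, finrank_bot, Module.finrank_fin_fun, zero_add]
  · intro x hx hwt
    refine absurd ?_ hx
    have h0 : {k : Fin n | x k ≠ 0 ∨ (0 : Fin n → F) k ≠ 0} = ∅ :=
      (Set.ncard_eq_zero (Set.toFinite _)).1 (Nat.lt_one_iff.1 hwt)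
    ext k
    by_contra hk
    exact h0.subset (Or.inl hk : k ∈ {k : Fin n | x k ≠ 0 ∨ (0 : Fin n → F) k ≠ 0})
  · refine ⟨Pi.single ⟨0, hn⟩ 1, trivial, by simp [hdual], ?_⟩
    rw [errorWeight, Set.ncard_eq_one]
    refine ⟨⟨0, hn⟩, ?_⟩
    ext k
    simp [Pi.single_apply]

/-- The CSS code of a hyperplane orthogonal to a self-orthogonal vector of full weight. -/
theorem cssGivesMDS_of_mem_iff_dotProduct_eq_zero (hn : 3 ≤ n) {C : Submodule F (Fin n → F)}
    {w : Fin n → F} (hC : ∀ x, x ∈ C ↔ x ⬝ᵥ w = 0) (hw : ∀ i, w i ≠ 0) (hww : w ⬝ᵥ w = 0) :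
    CSSGivesMDS p C (n - 2) 2 := by
  classical
  have hn0 : 0 < n := by omega
  have hn1 : 1 < n := by omega
  set e : Fin n := ⟨0, hn0⟩ with he
  set f : Fin n := ⟨1, hn1⟩ with hf
  have hef : e ≠ f := by simp [he, hf, Fin.ext_iff]
  -- Orthogonality to these vectors forces proportionality to `w`; the one with `i = f` is also the
  -- undetected error of weight two.
  have hbin : ∀ i, (Pi.single e (w i) - Pi.single i (w e) : Fin n → F) ∈ C := fun i => by
    rw [hC, sub_dotProduct, single_dotProduct, single_dotProduct, mul_comm, sub_self]
  have hdual : dualCode C = F ∙ w := by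
    apply le_antisymm
    · intro x hx
      refine Submodule.mem_span_singleton.2 ⟨x e / w e, ?_⟩
      ext i
      have := hx _ (hbin i)
      rw [dotProduct_sub, dotProduct_single, dotProduct_single, sub_eq_zero] at this
      rw [Pi.smul_apply, smul_eq_mul, div_mul_eq_mul_div, this, mul_div_cancel_right₀ _ (hw e)]
    · rw [Submodule.span_singleton_le_iff_mem]
      intro y hy
      rw [dotProduct_comm]
      exact (hC y).1 hy
  have hle : dualCode C ≤ C := by
    rw [hdual, Submodule.span_singleton_le_iff_mem, hC]
    exact hww
  have hw0 : w ≠ 0 := fun h => hw e (by simp [h])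
  have hker : C = LinearMap.ker (dotProductBilin F F |>.flip w) := by
    ext x
    rw [hC]
    rfl
  have hrank : Module.finrank F C + 1 = n := by
    rw [hker]
    have := Module.Dual.finrank_ker_add_one_of_ne_zero
      (f := ((dotProductBilin F F).flip w : Module.Dual F (Fin n → F))) (fun h => by
      have := LinearMap.congr_fun h (Pi.single e 1)
      exact hw e (by simpa using this))
    simpa using this
  refine ⟨hle, isQECCode_cssCode_dualCode p hle ?_ ?_ ?_, by push_cast [(by omega : 2 ≤ n)]; ring⟩
  · rw [hdual, finrank_span_singleton hw0]
    omega
  · intro x hx hwt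
    refine ⟨w, hdual ▸ Submodule.mem_span_singleton_self w, fun hwx => ?_⟩
    obtain ⟨i, hi⟩ := Function.ne_iff.1 hx
    have hsingle : ∀ k, k ≠ i → x k = 0 := by
      intro k hki
      by_contra hk
      have h1 := (Set.ncard_le_one (Set.toFinite _)).1 (Nat.lt_succ_iff.1 hwt) k (Or.inl hk) i
        (Or.inl hi)
      exact hki h1
    rw [dotProduct, Finset.sum_eq_single i (fun k _ hk => by rw [hsingle k hk, mul_zero])
      (by simp)] at hwx
    exact (mul_ne_zero (hw i) hi) hwx
  · refine ⟨_, hbin f, ?_, ?_⟩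
    · rw [hdual, Submodule.mem_span_singleton]
      rintro ⟨c, hc⟩
      -- This is where `3 ≤ n` enters: the witness vanishes at position `2` and `w` does not, so the
      -- scalar is zero.
      have hc2 := congrFun hc ⟨2, by omega⟩
      have hce := congrFun hc e
      have h2 : c = 0 := by
        simpa [he, hf, Pi.single_apply, Fin.ext_iff, hw] using hc2
      have hce0 : 0 = w f := by simpa [h2, hef] using hce
      exact hw f hce0.symm
    · rw [errorWeight, Set.ncard_eq_two]
      refine ⟨e, f, hef, ?_⟩
      ext k
      by_cases hke : k = e
      · subst hke
        simp [hef, hw]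
      · by_cases hkf : k = f
        · subst hkf
          simp [hw, hke]
        · simp [hke, hkf]

end Quantum

/-! ### Cyclic codes generated by a linear factor -/

section Cyclic

theorem toQuotient_apply {F : Type*} [Field F] {n : ℕ} (x : Fin n → F) :
    toQuotient F n x = Ideal.Quotient.mk (Ideal.span {(X ^ n - 1 : F[X])})
      (∑ i : Fin n, monomial (i : ℕ) (x i)) := by
  simp [toQuotient]

/-- As `g` divides `X ^ n - 1`, divisibility by `g` does not depend on the representative of a
residue class. -/
theorem mem_cyclicCode {F : Type*} [Field F] {n : ℕ} {g : F[X]} (hg : g ∣ X ^ n - 1)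
    (x : Fin n → F) : x ∈ cyclicCode n g ↔ g ∣ ∑ i : Fin n, monomial (i : ℕ) (x i) := by
  have h1 : x ∈ cyclicCode n g ↔
      toQuotient F n x ∈ Ideal.span {Ideal.Quotient.mk (Ideal.span {(X ^ n - 1 : F[X])}) g} :=
    Iff.rfl
  rw [h1, toQuotient_apply, Ideal.mem_span_singleton]
  constructor
  · rintro ⟨c, hc⟩
    obtain ⟨c, rfl⟩ := Ideal.Quotient.mk_surjective c
    rw [← map_mul, Ideal.Quotient.eq, Ideal.mem_span_singleton] at hc
    exact (dvd_sub_left (dvd_mul_right g c)).1 (hg.trans hc)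
  · exact map_dvd _

theorem cyclicCode_one {F : Type*} [Field F] (n : ℕ) : cyclicCode n (1 : F[X]) = ⊤ :=
  (Submodule.eq_top_iff').2 fun x => (mem_cyclicCode (one_dvd _) x).2 (one_dvd _)

theorem mem_cyclicCode_X_sub_C {F : Type*} [Field F] {n : ℕ} {γ : F} (hγ : γ ^ n = 1)
    (x : Fin n → F) :
    x ∈ cyclicCode n (X - C γ) ↔ x ⬝ᵥ (fun i : Fin n => γ ^ (i : ℕ)) = 0 := by
  rw [mem_cyclicCode (by simp [dvd_iff_isRoot, hγ]), dvd_iff_isRoot, IsRoot.def, eval_finsetSum]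
  simp [dotProduct]

/-- The squares of the powers of an `n`-th root of unity sum to zero when `n = 0` in the field. -/
theorem dotProduct_pow_self_eq_zero {F : Type*} [Field F] {n : ℕ} {γ : F} (hγ : γ ^ n = 1)
    (hn : (n : F) = 0) :
    (fun i : Fin n => γ ^ (i : ℕ)) ⬝ᵥ (fun i : Fin n => γ ^ (i : ℕ)) = 0 := by
  have h1 : (fun i : Fin n => γ ^ (i : ℕ)) ⬝ᵥ (fun i : Fin n => γ ^ (i : ℕ)) =
      ∑ i ∈ Finset.range n, (γ ^ 2) ^ i := by
    rw [dotProduct, Finset.sum_range]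
    exact Finset.sum_congr rfl fun i _ => by rw [← mul_pow, sq]
  rw [h1]
  -- For `γ = ±1` each term is `1` and the sum is `n = 0`; otherwise the geometric sum has numerator
  -- `γ^(2n) - 1 = 0`.
  by_cases h2 : γ ^ 2 = 1
  · simp [h2, hn]
  · rw [geom_sum_eq h2, ← pow_mul, mul_comm, pow_mul, hγ, one_pow, sub_self, zero_div]

theorem cssGivesMDS_cyclicCode_X_sub_C (p : ℕ) [Fact p.Prime] {F : Type*} [Field F] [Fintype F]
    [Algebra (ZMod p) F] {n : ℕ} (h3 : 3 ≤ n) (hpn : p ∣ n) {γ : F} (hγ : γ ^ n = 1) :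
    CSSGivesMDS p (cyclicCode n (X - C γ)) (n - 2) 2 := by
  have := charP_of_injective_algebraMap (algebraMap (ZMod p) F).injective p
  have hγ0 : γ ≠ 0 := by
    rintro rfl
    rw [zero_pow (by omega)] at hγ
    exact zero_ne_one hγ
  exact cssGivesMDS_of_mem_iff_dotProduct_eq_zero p h3 (mem_cyclicCode_X_sub_C hγ)
    (fun i => pow_ne_zero _ hγ0)
    (dotProduct_pow_self_eq_zero hγ ((CharP.cast_eq_zero_iff F p n).2 hpn))

/-- The elements of `F` already supply all `q` roots of `X^q - X`. -/
theorem mem_range_algebraMap_of_pow_card_eq {F : Type*} [Field F] [Fintype F] {K : Type*} [Field K]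
    [Algebra F K] {x : K} (hx : x ^ Fintype.card F = x) : x ∈ (algebraMap F K).range := by
  have hs : (X ^ Fintype.card F - X : F[X]).Splits := by
    rw [splits_iff_card_roots, FiniteField.roots_X_pow_card_sub_X,
      FiniteField.X_pow_card_sub_X_natDegree_eq F Fintype.one_lt_card]
    rfl
  refine hs.mem_range_of_isRoot (FiniteField.X_pow_card_sub_X_ne_zero F Fintype.one_lt_card) ?_
  simp [hx]

variable {F : Type*} [Field F] {K : Type*} [Field K] [Algebra F K] {r : ℕ}

theorem genPoly_eq_one (β : K) {T : Finset (ZMod (2 ^ r))} {j : ZMod (2 ^ r) → ℕ}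
    (hj : ∀ h ∈ T, j h = 0) : genPoly F β T j = 1 :=
  Finset.prod_eq_one fun h hh => by rw [hj h hh, pow_zero]

theorem genPoly_eq_minpoly (β : K) {T : Finset (ZMod (2 ^ r))} {j : ZMod (2 ^ r) → ℕ}
    {h : ZMod (2 ^ r)} (hh : h ∈ T) (hj : j h = 1) (hj' : ∀ h' ∈ T, h' ≠ h → j h' = 0) :
    genPoly F β T j = minpoly F (β ^ h.val) := by
  rw [genPoly, Finset.prod_eq_single_of_mem h hh fun h' hh' hne => by rw [hj' h' hh' hne, pow_zero],
    hj, pow_one]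

theorem pow_val_pow_eq_one {β : K} (hβ : β ^ 2 ^ r = 1) {h : ZMod (2 ^ r)} {N : ℕ}
    (hN : (N : ZMod (2 ^ r)) * h = 0) : (β ^ h.val) ^ N = 1 := by
  have hdvd : 2 ^ r ∣ h.val * N := by
    rw [← ZMod.natCast_eq_zero_iff, Nat.cast_mul, ZMod.natCast_zmod_val, mul_comm, hN]
  obtain ⟨c, hc⟩ := hdvd
  rw [← pow_mul, hc, pow_mul, hβ, one_pow]

theorem cssGivesMDS_genPoly_of_forall_eq_zero (p : ℕ) [Fact p.Prime] [Fintype F]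
    [Algebra (ZMod p) F] {n : ℕ} (hn : 0 < n) (β : K) {T : Finset (ZMod (2 ^ r))}
    {j : ZMod (2 ^ r) → ℕ} (hj : ∀ h ∈ T, j h = 0) :
    CSSGivesMDS p (cyclicCode n (genPoly F β T j)) n 1 := by
  rw [genPoly_eq_one β hj, cyclicCode_one]
  exact cssGivesMDS_top p hn

/-- If the generator is the minimal polynomial of a power `β^h` whose order divides `q - 1`,
then the CSS code has distance two. -/
theorem cssGivesMDS_genPoly_of_mul_eq_zero (p : ℕ) [Fact p.Prime] [Fintype F]
    [Algebra (ZMod p) F] {n : ℕ} (hn : 3 ≤ n) (hpn : p ∣ n) (hrn : 2 ^ r ∣ n) {β : K}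
    (hβ : β ^ 2 ^ r = 1) {T : Finset (ZMod (2 ^ r))} {j : ZMod (2 ^ r) → ℕ}
    {h : ZMod (2 ^ r)} (hh : h ∈ T) (hj : j h = 1) (hj' : ∀ h' ∈ T, h' ≠ h → j h' = 0)
    {N : ℕ} (hN : N ∣ Fintype.card F - 1) (hNh : (N : ZMod (2 ^ r)) * h = 0) :
    CSSGivesMDS p (cyclicCode n (genPoly F β T j)) (n - 2) 2 := by
  obtain ⟨γ, hγ⟩ : β ^ h.val ∈ (algebraMap F K).range := by
    refine mem_range_algebraMap_of_pow_card_eq ?_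
    obtain ⟨c, hc⟩ := hN
    rw [← Nat.sub_add_cancel Fintype.card_pos, hc, pow_succ, pow_mul, pow_val_pow_eq_one hβ hNh,
      one_pow, one_mul]
  rw [genPoly_eq_minpoly β hh hj hj', ← hγ, minpoly.eq_X_sub_C]
  refine cssGivesMDS_cyclicCode_X_sub_C p hn hpn ((algebraMap F K).injective ?_)
  obtain ⟨c, rfl⟩ := hrn
  rw [map_pow, hγ, map_one, ← pow_mul, mul_left_comm, pow_mul, hβ, one_pow]

theorem repsD_mono (a r : ℕ) {l l' : ℕ} (hl : l ≤ l') : repsD a r l ⊆ repsD a r l' :=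
  Finset.union_subset_union_right
    (Finset.biUnion_subset_biUnion_of_subset_left _ (Finset.Icc_subset_Icc_right hl))

/-- Layer `i ≤ l` consists of multiples of `2^(r-i)`, killed by `2^l` modulo `2^r`. The element
`2^(r-1)` plays the role of layer `1`, hence `1 ≤ l`. -/
theorem two_pow_mul_eq_zero_of_mem_repsD {a l : ℕ} (hl : 1 ≤ l) {h : ZMod (2 ^ r)}
    (hh : h ∈ repsD a r l) : ((2 ^ l : ℕ) : ZMod (2 ^ r)) * h = 0 := by
  have key : ∀ i, i ≤ l →
      ((2 ^ l : ℕ) : ZMod (2 ^ r)) * 2 ^ (r - i) = 0 := by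
    intro i hi
    have h2 : ((2 ^ l * 2 ^ (r - i) : ℕ) : ZMod (2 ^ r)) = 0 := by
      rw [ZMod.natCast_eq_zero_iff, ← pow_add]
      exact pow_dvd_pow 2 (by omega)
    exact_mod_cast h2
  simp only [repsD, layerD, Finset.mem_union, Finset.mem_insert, Finset.mem_singleton,
    Finset.mem_biUnion, Finset.mem_Icc] at hh
  rcases hh with (rfl | rfl) | ⟨i, ⟨-, hi⟩, t, -, rfl | rfl⟩
  · exact mul_zero _
  · exact key 1 hl
  · rw [← mul_assoc, key i hi, zero_mul]
  · rw [mul_neg, ← mul_assoc, key i hi, zero_mul, neg_zero]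

end Cyclic

theorem exists_mem_eq_one_of_sum_eq_one {ι : Type*} {T : Finset ι} {j : ι → ℕ}
    (hj : ∑ h ∈ T, j h = 1) : ∃ h ∈ T, j h = 1 ∧ ∀ h' ∈ T, h' ≠ h → j h' = 0 := by
  classical
  obtain ⟨h, hh, h0⟩ := Finset.exists_ne_zero_of_sum_ne_zero (by rw [hj]; exact one_ne_zero)
  rw [← Finset.add_sum_erase T j hh] at hj
  have hsum : ∑ h ∈ T.erase h, j h = 0 := by omega
  exact ⟨h, hh, by omega, fun h' hh' hne =>
    Finset.sum_eq_zero_iff.1 hsum h' (Finset.mem_erase.2 ⟨hne, hh'⟩)⟩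

end QCode

/-! ### The three cases for `q` -/

theorem theorem17 {p m a b r s : ℕ} [Fact p.Prime] (hp : p ≠ 2) (ha : 2 ≤ a) (hb : Odd b)
    (hr : 1 ≤ r) (hs : 1 ≤ s)
    {F : Type*} [Field F] [Fintype F] [Algebra (ZMod p) F] (hF : Fintype.card F = p ^ m)
    {K : Type*} [Field K] [Algebra F K] (β : K) (hβ : IsPrimitiveRoot β (2 ^ r))
    (j : ZMod (2 ^ r) → ℕ) :
    -- `q = 2^a b + 1` and `a ≥ r`
    (p ^ m = 2 ^ a * b + 1 → r ≤ a → (∀ h ∈ QCode.repsD a r r, j h ≤ p ^ s) →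
      ((∀ h ∈ QCode.repsD a r r, j h = 0) →
        QCode.CSSGivesMDS p
          (QCode.cyclicCode (2 ^ r * p ^ s) (QCode.genPoly F β (QCode.repsD a r r) j))
          (2 ^ r * p ^ s) 1) ∧
      (∑ h ∈ QCode.repsD a r r, j h = 1 →
        QCode.CSSGivesMDS p
          (QCode.cyclicCode (2 ^ r * p ^ s) (QCode.genPoly F β (QCode.repsD a r r) j))
          (2 ^ r * p ^ s - 2) 2)) ∧
    -- `q = 2^a b + 1` and `a < r`
    (p ^ m = 2 ^ a * b + 1 → a < r → (∀ h ∈ QCode.repsD a r r, j h ≤ p ^ s) →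
      ((∀ h ∈ QCode.repsD a r r, j h = 0) →
        QCode.CSSGivesMDS p
          (QCode.cyclicCode (2 ^ r * p ^ s) (QCode.genPoly F β (QCode.repsD a r r) j))
          (2 ^ r * p ^ s) 1) ∧
      (∑ h ∈ QCode.repsD a r a, j h = 1 →
        (∀ h ∈ QCode.repsD a r r, h ∉ QCode.repsD a r a → j h = 0) →
        QCode.CSSGivesMDS p
          (QCode.cyclicCode (2 ^ r * p ^ s) (QCode.genPoly F β (QCode.repsD a r r) j))
          (2 ^ r * p ^ s - 2) 2)) ∧
    -- `q = 2^a b - 1`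
    (p ^ m + 1 = 2 ^ a * b → (∀ h ∈ QCode.repsO a r, j h ≤ p ^ s) →
      ((∀ h ∈ QCode.repsO a r, j h = 0) →
        QCode.CSSGivesMDS p
          (QCode.cyclicCode (2 ^ r * p ^ s) (QCode.genPoly F β (QCode.repsO a r) j))
          (2 ^ r * p ^ s) 1) ∧
      ((∃ h, (h = 0 ∨ h = 2 ^ (r - 1)) ∧ j h = 1 ∧
          ∀ h' ∈ QCode.repsO a r, h' ≠ h → j h' = 0) →
        QCode.CSSGivesMDS p
          (QCode.cyclicCode (2 ^ r * p ^ s) (QCode.genPoly F β (QCode.repsO a r) j))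
          (2 ^ r * p ^ s - 2) 2)) := by

  have hp2 : 2 ≤ p := (Fact.out : p.Prime).two_le
  have h3 : 3 ≤ 2 ^ r * p ^ s := by
    have h1 : 2 ≤ 2 ^ r := Nat.le_self_pow (by omega) 2
    have h2 : p ≤ p ^ s := Nat.le_self_pow (by omega) p
    have h4 := Nat.mul_le_mul h1 (hp2.trans h2)
    omega
  have hpn : p ∣ 2 ^ r * p ^ s := (dvd_pow_self p (by omega)).mul_left _
  have hrn : 2 ^ r ∣ 2 ^ r * p ^ s := dvd_mul_right _ _
  have hβ1 : β ^ 2 ^ r = 1 := hβ.pow_eq_one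
  have h0 : ∀ T : Finset (ZMod (2 ^ r)), (∀ h ∈ T, j h = 0) → QCode.CSSGivesMDS p
      (QCode.cyclicCode (2 ^ r * p ^ s) (QCode.genPoly F β T j)) (2 ^ r * p ^ s) 1 :=
    fun T => QCode.cssGivesMDS_genPoly_of_forall_eq_zero p (by omega) β
  refine ⟨fun hq hra _ => ⟨h0 _, fun hj => ?_⟩, fun hq har _ => ⟨h0 _, fun hj hj' => ?_⟩,
    fun hq _ => ⟨h0 _, ?_⟩⟩
  · obtain ⟨h, hh, h1, h2⟩ := QCode.exists_mem_eq_one_of_sum_eq_one hj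
    refine QCode.cssGivesMDS_genPoly_of_mul_eq_zero p h3 hpn hrn hβ1 hh h1 h2 (N := 2 ^ r) ?_ ?_
    · rw [hF, hq, Nat.add_sub_cancel]
      exact (pow_dvd_pow 2 hra).mul_right b
    · exact QCode.two_pow_mul_eq_zero_of_mem_repsD hr hh
  · obtain ⟨h, hh, h1, h2⟩ := QCode.exists_mem_eq_one_of_sum_eq_one hj
    -- Now `2^r` need not divide `q - 1`, but `2^a` does, and it kills the layers up to `a`.
    refine QCode.cssGivesMDS_genPoly_of_mul_eq_zero p h3 hpn hrn hβ1
      (QCode.repsD_mono a r har.le hh) h1 (fun h' hh' hne => ?_) (N := 2 ^ a) ?_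
      (QCode.two_pow_mul_eq_zero_of_mem_repsD (by omega) hh)
    · by_cases hh'' : h' ∈ QCode.repsD a r a
      · exact h2 h' hh'' hne
      · exact hj' h' hh' hh''
    · rw [hF, hq, Nat.add_sub_cancel]
      exact dvd_mul_right _ _
  · rintro ⟨h, hh, h1, h2⟩
    have hmem : h ∈ QCode.repsO a r := by
      rcases hh with rfl | rfl <;> simp [QCode.repsO]
    -- Here `β^h = ±1`, and only `2 ∣ q - 1` is needed, from `q` being odd.
    refine QCode.cssGivesMDS_genPoly_of_mul_eq_zero p h3 hpn hrn hβ1 hmem h1 h2 (N := 2) ?_ ?_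
    · rw [hF]
      exact (((Fact.out : p.Prime).odd_of_ne_two hp).pow.tsub_odd odd_one).two_dvd
    · rcases hh with rfl | rfl
      · exact mul_zero _
      · rw [Nat.cast_ofNat, ← pow_succ', Nat.sub_add_cancel hr]
        exact_mod_cast ZMod.natCast_self (2 ^ r)
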